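/- Let $(X,d)$ be a compact metric space and let $R>0$ be such that $X$ is simply connected up to scale $R$, i.e. for every $x\in X$ and every $\rho$ with $0<\rho<R$ the open ball $\{y\in X: d(x,y)<\rho\}$ is simply connected (in particular path connected). For $r>0$ let $\mathrm{Rips}(X,r)$ be the (open) Rips complex, the abstract simplicial complex whose simplices are the nonempty finite subsets of $X$ of diameter less than $r$. Let $G$ be an abelian group, and take homology with coefficients in $G$: simplicial homology for $\mathrm{Rips}(X,r)$ and singular homology for $X$. Then for every $r$ with $0<r<R/3$, $$H_1(\mathrm{Rips}(X,r);G)\cong H_1(X;G).$$ Furthermore, for all $0<r<r'<R/3$ the natural inclusion $\mathrm{Rips}(X,r)\hookrightarrow \mathrm{Rips}(X,r')$ induces an isomorphism $H_1(\mathrm{Rips}(X,r);G)\to H_1(\mathrm{Rips}(X,r');G)$. -/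

import Mathlib

open CategoryTheory Opposite

universe v u

namespace PreAbstractSimplicialComplex

variable {ι : Type u}

open Classical in
/-- The simplicial set of ordered simplices of an abstract simplicial complex `K`: its
`n`-simplices are the `(n+1)`-tuples `(x₀, …, xₙ)` of vertices, repetitions allowed, whose set of
entries `{x₀, …, xₙ}` is a face of `K`; the `i`-th face map omits `xᵢ`. -/
def orderedSSet (K : PreAbstractSimplicialComplex ι) : SSet.{u} where
  obj n := { x : Fin (n.unop.len + 1) → ι // Finset.univ.image x ∈ K.faces }
  map f := TypeCat.ofHom fun x =>
    ⟨x.1 ∘ f.unop.toOrderHom, (K.isRelLowerSet_faces x.2).2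
      (by
        intro a ha
        obtain ⟨i, -, rfl⟩ := Finset.mem_image.1 ha
        exact Finset.mem_image_of_mem x.1 (Finset.mem_univ (f.unop.toOrderHom i)))
      (Finset.univ_nonempty.image _)⟩

/-- The map of ordered simplices induced by an inclusion `K ≤ L` of abstract simplicial complexes. -/
def orderedSSetIncl {K L : PreAbstractSimplicialComplex ι} (h : K ≤ L) :
    K.orderedSSet ⟶ L.orderedSSet where
  app _ := TypeCat.ofHom fun x => ⟨x.1, h x.2⟩

/-- The `n`-th simplicial homology group of an abstract simplicial complex `K` with coefficients in
the abelian group `G`: the homology of the complex of ordered chains of `K`, whose `n`-chains are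
the finite formal `G`-linear combinations of the tuples `(x₀, …, xₙ)` of vertices spanning a face
of `K`, with boundary `∂ (x₀, …, xₙ) = ∑ i, (-1)^i (x₀, …, x̂ᵢ, …, xₙ)`. -/
noncomputable def simplicialHomology (K : PreAbstractSimplicialComplex ι)
    (G : AddCommGrpCat.{max u v}) (n : ℕ) : AddCommGrpCat.{max u v} :=
  K.orderedSSet.homology G n

/-- The homomorphism of simplicial homology groups induced by an inclusion `K ≤ L`. -/
noncomputable def simplicialHomologyIncl {K L : PreAbstractSimplicialComplex ι} (h : K ≤ L)
    (G : AddCommGrpCat.{max u v}) (n : ℕ) :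
    K.simplicialHomology G n ⟶ L.simplicialHomology G n :=
  SSet.homologyMap (orderedSSetIncl h) G n

end PreAbstractSimplicialComplex

/-- The (open) Rips complex of `X` at scale `r`: a nonempty finite subset of `X` is a simplex iff
its diameter is less than `r`. -/
def Rips (X : Type u) [MetricSpace X] (r : ℝ) : PreAbstractSimplicialComplex X where
  faces := { σ | σ.Nonempty ∧ Metric.diam (σ : Set X) < r }
  isRelLowerSet_faces := fun _ hσ =>
    ⟨hσ.1, fun _ hτ hne => ⟨hne, lt_of_le_of_lt
      (Metric.diam_mono (Finset.coe_subset.2 hτ) (Finset.finite_toSet _).isBounded) hσ.2⟩⟩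

/-- The natural inclusion `Rips(X, r) ⊆ Rips(X, s)` for `r ≤ s`. -/
theorem Rips_mono (X : Type u) [MetricSpace X] {r s : ℝ} (h : r ≤ s) : Rips X r ≤ Rips X s :=
  fun _ hσ => ⟨hσ.1, lt_of_lt_of_le hσ.2 h⟩

/-- `X` is simply connected up to scale `R`: every open ball of positive radius less than `R` is
simply connected (in particular path connected). -/
def SimplyConnectedUpToScale (X : Type u) [MetricSpace X] (R : ℝ) : Prop :=
  ∀ (x : X) (r : ℝ), 0 < r → r < R → IsSimplyConnected (Metric.ball x r)

/-- The `n`-th singular homology group of a topological space `X` with coefficients in `G`. -/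
noncomputable def singularHomologyGroup (X : Type u) [TopologicalSpace X]
    (G : AddCommGrpCat.{max u v}) (n : ℕ) : AddCommGrpCat.{max u v} :=
  ((AlgebraicTopology.singularHomologyFunctor.{u} AddCommGrpCat.{max u v} n).obj G).obj
    (TopCat.of X)

/-!
A singular path is replaced by the chain of Rips edges through sufficiently fine samples of it
(`sampling`), and a Rips edge by a path in the `r`-ball around its first vertex (`filling`). Modulo
boundaries, the first does not depend on the fineness, because refining a fine chain only adds
triangles, and the second does not depend on the path, because everything happens in a simply
connected ball of radius `2 * r`; for the same reasons both send boundaries to boundaries.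
The composites are homologous to the identity: filling the samples of a path cuts it into short
subpaths up to homotopy, and all samples of a filled edge lie close to its first vertex. So
`sampling` induces an isomorphism on `H₁`, for which only chains in degrees at most `2` matter. It
is compatible with the inclusions of Rips complexes, so these are isomorphisms on `H₁` as well. -/

open Limits Simplicial unitInterval

section Chains

/-- Integral `n`-chains of a simplicial set, not normalised: degenerate simplices are kept. -/
abbrev IntegralChain (X : SSet.{u}) (n : ℕ) : Type u := FreeAbelianGroup (X _⦋n⦌)

namespace IntegralChain

variable {X Y Z : SSet.{u}}

/-- The boundary `∂ x = ∑ i, (-1)^i dᵢ x` of integral chains. -/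
noncomputable def boundary (X : SSet.{u}) (n : ℕ) : IntegralChain X (n + 1) →+ IntegralChain X n :=
  FreeAbelianGroup.lift fun x => ∑ i : Fin (n + 2), (-1 : ℤ) ^ i.val • .of (X.δ i x)

lemma boundary_of {n : ℕ} (x : X _⦋n + 1⦌) :
    boundary X n (.of x) = ∑ i : Fin (n + 2), (-1 : ℤ) ^ i.val • .of (X.δ i x) :=
  FreeAbelianGroup.lift_apply_of _ _

lemma boundary_zero_of (x : X _⦋1⦌) : boundary X 0 (.of x) = .of (X.δ 0 x) - .of (X.δ 1 x) := by
  simp [boundary_of, Fin.sum_univ_two, sub_eq_add_neg]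

lemma boundary_one_of (x : X _⦋2⦌) :
    boundary X 1 (.of x) = .of (X.δ 0 x) - .of (X.δ 1 x) + .of (X.δ 2 x) := by
  simp [boundary_of, Fin.sum_univ_three, sub_eq_add_neg]

lemma boundary_map (i : X ⟶ Y) (n : ℕ) (c : IntegralChain X (n + 1)) :
    boundary Y n (FreeAbelianGroup.map (i.app _) c) =
      FreeAbelianGroup.map (i.app _) (boundary X n c) := by
  suffices (boundary Y n).comp (FreeAbelianGroup.map (i.app _)) =
      (FreeAbelianGroup.map (i.app _)).comp (boundary X n) from DFunLike.congr_fun this c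
  ext x
  simp [boundary_of, SSet.δ_naturality_apply]

variable {C : Type*} [Category* C] [Preadditive C] [HasCoproducts.{u} C] {n m k : ℕ}

/-- The morphism `A ⟶ A ⊗ Cₙ(X)`, `a ↦ a ⊗ c`, given by an integral chain `c`. -/
noncomputable def toHom (A : C) : IntegralChain X n →+ (A ⟶ (X.chainComplex A).X n) :=
  FreeAbelianGroup.lift fun x => X.ιChainComplex x

@[simp]
lemma toHom_of (A : C) (x : X _⦋n⦌) : toHom A (.of x) = X.ιChainComplex x :=
  FreeAbelianGroup.lift_apply_of _ _

/-- The morphism `A ⊗ f : A ⊗ Cₙ(X) ⟶ A ⊗ Cₘ(Y)` of chains with coefficients in `A`. -/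
noncomputable def baseChange (A : C) (f : IntegralChain X n →+ IntegralChain Y m) :
    (X.chainComplex A).X n ⟶ (Y.chainComplex A).X m :=
  Cofan.IsColimit.desc (X.isColimitChainComplexXCofan A n) fun x => toHom A (f (.of x))

@[simp]
lemma ι_baseChange (A : C) (f : IntegralChain X n →+ IntegralChain Y m) (x : X _⦋n⦌) :
    X.ιChainComplex x ≫ baseChange A f = toHom A (f (.of x)) :=
  Cofan.IsColimit.fac (X.isColimitChainComplexXCofan A n) _ x

lemma toHom_comp_baseChange (A : C) (f : IntegralChain X n →+ IntegralChain Y m)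
    (c : IntegralChain X n) : toHom A c ≫ baseChange A f = toHom A (f c) := by
  induction c using FreeAbelianGroup.induction_on with
  | zero => simp
  | of x => simp
  | neg x h => simp only [map_neg, Preadditive.neg_comp, h]
  | add x y hx hy => simp only [map_add, Preadditive.add_comp, hx, hy]

lemma baseChange_comp (A : C) (f : IntegralChain X n →+ IntegralChain Y m)
    (g : IntegralChain Y m →+ IntegralChain Z k) :
    baseChange A (g.comp f) = baseChange A f ≫ baseChange A g :=
  SSet.chainComplex_hom_ext fun x => by
    rw [ι_baseChange, ← Category.assoc, ι_baseChange, toHom_comp_baseChange,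
      AddMonoidHom.comp_apply]

lemma baseChange_add (A : C) (f g : IntegralChain X n →+ IntegralChain Y m) :
    baseChange A (f + g) = baseChange A f + baseChange A g :=
  SSet.chainComplex_hom_ext fun x => by simp

lemma baseChange_boundary (A : C) (n : ℕ) :
    baseChange A (boundary X n) = (X.chainComplex A).d (n + 1) n :=
  SSet.chainComplex_hom_ext fun x => by simp [boundary_of]

lemma baseChange_map (A : C) (i : X ⟶ Y) (n : ℕ) :
    baseChange A (FreeAbelianGroup.map (i.app (op ⦋n⦌))) = (SSet.chainComplexMap i A).f n :=
  SSet.chainComplex_hom_ext fun x => by simp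

end IntegralChain

/-- Integral `1`-chains modulo boundaries. -/
abbrev ChainClass (X : SSet.{u}) : Type u :=
  IntegralChain X 1 ⧸ (IntegralChain.boundary X 1).range

namespace ChainClass

variable {X Y : SSet.{u}}

/-- The class of an integral `1`-chain modulo boundaries. -/
noncomputable def mk : IntegralChain X 1 →+ ChainClass X :=
  QuotientAddGroup.mk' _

lemma mk_eq_zero_iff {c : IntegralChain X 1} :
    mk c = 0 ↔ c ∈ (IntegralChain.boundary X 1).range :=
  QuotientAddGroup.eq_zero_iff _

lemma map_boundary_mem_range_iff (f : IntegralChain X 1 →+ IntegralChain Y 1) (x : X _⦋2⦌) :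
    f (IntegralChain.boundary X 1 (.of x)) ∈ (IntegralChain.boundary Y 1).range ↔
      mk (f (.of (X.δ 2 x))) + mk (f (.of (X.δ 0 x))) = mk (f (.of (X.δ 1 x))) := by
  rw [← mk_eq_zero_iff, IntegralChain.boundary_one_of, map_add, map_sub, map_add, map_sub,
    sub_add_eq_add_sub, sub_eq_zero, add_comm]

lemma mk_triangle (x : X _⦋2⦌) :
    mk (.of (X.δ 2 x)) + mk (.of (X.δ 0 x)) = mk (.of (X.δ 1 x)) :=
  (map_boundary_mem_range_iff (.id _) x).1 ⟨.of x, rfl⟩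

end ChainClass

end Chains

section TruncatedChainMap

open IntegralChain

lemma exists_comp_eq_of_forall_of_mem_range {S A B : Type*} [AddCommGroup A] [AddCommGroup B]
    (f : A →+ B) (g : FreeAbelianGroup S →+ B) (h : ∀ s, g (.of s) ∈ f.range) :
    ∃ l : FreeAbelianGroup S →+ A, f.comp l = g := by
  choose a ha using h
  exact ⟨FreeAbelianGroup.lift a, by ext s; simp [ha]⟩

lemma homologyMap_eq_of_τ₂_eq_add {C : Type*} [Category* C] [Preadditive C] {S T : ShortComplex C}
    [S.HasHomology] [T.HasHomology] {φ ψ : S ⟶ T} (h : S.X₂ ⟶ T.X₁)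
    (h₂ : φ.τ₂ = h ≫ T.f + ψ.τ₂) (h₃ : φ.τ₃ = ψ.τ₃) :
    ShortComplex.homologyMap φ = ShortComplex.homologyMap ψ :=
  ShortComplex.Homotopy.homologyMap_congr
    { h₀ := φ.τ₁ - ψ.τ₁ - S.f ≫ h
      h₁ := h
      h₂ := 0
      h₃ := 0
      h₀_f := by simp [Preadditive.sub_comp, φ.comm₁₂, ψ.comm₁₂, h₂]
      comm₁ := by abel
      comm₂ := by simpa using h₂
      comm₃ := by simpa using h₃ }

/-- A homomorphism of integral chains in degrees `0` and `1` that extends to a chain map in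
degrees at most `2`. The extension to degree `2` is not recorded, since it does not affect the
induced map on `H₁`. -/
structure TruncatedChainMap (X Y : SSet.{u}) where
  app₀ : IntegralChain X 0 →+ IntegralChain Y 0
  app₁ : IntegralChain X 1 →+ IntegralChain Y 1
  boundary_app₁ (x : X _⦋1⦌) : boundary Y 0 (app₁ (.of x)) = app₀ (boundary X 0 (.of x))
  app₁_boundary (x : X _⦋2⦌) : app₁ (boundary X 1 (.of x)) ∈ (boundary Y 1).range

namespace TruncatedChainMap

variable {X Y Z : SSet.{u}}

lemma boundary_comp_app₁ (f : TruncatedChainMap X Y) :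
    (boundary Y 0).comp f.app₁ = f.app₀.comp (boundary X 0) := by
  ext x
  exact f.boundary_app₁ x

lemma exists_boundary_comp_eq (f : TruncatedChainMap X Y) :
    ∃ f₂ : IntegralChain X 2 →+ IntegralChain Y 2,
      (boundary Y 1).comp f₂ = f.app₁.comp (boundary X 1) :=
  exists_comp_eq_of_forall_of_mem_range _ _ f.app₁_boundary

/-- The truncated chain map induced by a morphism of simplicial sets. -/
noncomputable def ofHom (i : X ⟶ Y) : TruncatedChainMap X Y where
  app₀ := FreeAbelianGroup.map (i.app _)
  app₁ := FreeAbelianGroup.map (i.app _)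
  boundary_app₁ _ := boundary_map i 0 _
  app₁_boundary _ := ⟨_, boundary_map i 1 _⟩

/-- The composition of truncated chain maps. -/
noncomputable def comp (g : TruncatedChainMap Y Z) (f : TruncatedChainMap X Y) :
    TruncatedChainMap X Z where
  app₀ := g.app₀.comp f.app₀
  app₁ := g.app₁.comp f.app₁
  boundary_app₁ x := by
    rw [AddMonoidHom.comp_apply, AddMonoidHom.comp_apply, ← f.boundary_app₁]
    exact DFunLike.congr_fun g.boundary_comp_app₁ _
  app₁_boundary x := by
    obtain ⟨f₂, hf₂⟩ := f.exists_boundary_comp_eq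
    obtain ⟨g₂, hg₂⟩ := g.exists_boundary_comp_eq
    refine ⟨g₂ (f₂ (.of x)), (DFunLike.congr_fun hg₂ _).trans ?_⟩
    exact congrArg g.app₁ (DFunLike.congr_fun hf₂ _)

variable {C : Type*} [Category* C] [Preadditive C] [HasCoproducts.{u} C] (A : C)

/-- The morphism of complexes in degrees `2, 1, 0` given by a truncated chain map. -/
noncomputable def shortMap (f : TruncatedChainMap X Y) :
    (X.chainComplex A).sc' 2 1 0 ⟶ (Y.chainComplex A).sc' 2 1 0 where
  τ₁ := baseChange A f.exists_boundary_comp_eq.choose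
  τ₂ := baseChange A f.app₁
  τ₃ := baseChange A f.app₀
  comm₁₂ := by
    change _ ≫ (Y.chainComplex A).d 2 1 = (X.chainComplex A).d 2 1 ≫ _
    rw [← baseChange_boundary, ← baseChange_boundary, ← baseChange_comp, ← baseChange_comp,
      f.exists_boundary_comp_eq.choose_spec]
  comm₂₃ := by
    change _ ≫ (Y.chainComplex A).d 1 0 = (X.chainComplex A).d 1 0 ≫ _
    rw [← baseChange_boundary, ← baseChange_boundary, ← baseChange_comp, ← baseChange_comp,
      f.boundary_comp_app₁]

variable [CategoryWithHomology C]

/-- The first homology of a simplicial set is that of its chain complex in degrees `2, 1, 0`. -/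
noncomputable def homologyIso (X : SSet.{u}) :
    X.homology A 1 ≅ ((X.chainComplex A).sc' 2 1 0).homology :=
  (HomologicalComplex.homologyFunctorIso' C (.down ℕ) 2 1 0 (by simp) (by simp)).app _

/-- The map on first homology induced by a truncated chain map. -/
noncomputable def homologyMap (f : TruncatedChainMap X Y) : X.homology A 1 ⟶ Y.homology A 1 :=
  (homologyIso A X).hom ≫ ShortComplex.homologyMap (f.shortMap A) ≫ (homologyIso A Y).inv

variable {A}

lemma homologyMap_congr {f g : TruncatedChainMap X Y} (h₀ : f.app₀ = g.app₀)
    (h₁ : ∀ x : X _⦋1⦌, ChainClass.mk (f.app₁ (.of x)) = ChainClass.mk (g.app₁ (.of x))) :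
    f.homologyMap A = g.homologyMap A := by
  obtain ⟨l, hl⟩ := exists_comp_eq_of_forall_of_mem_range (boundary Y 1) (f.app₁ - g.app₁)
    fun x => ChainClass.mk_eq_zero_iff.1 (by rw [AddMonoidHom.sub_apply, map_sub, h₁, sub_self])
  have h₂ : baseChange A f.app₁ = baseChange A l ≫ (Y.chainComplex A).d 2 1 +
      baseChange A g.app₁ := by
    rw [← baseChange_boundary, ← baseChange_comp, hl, ← baseChange_add, sub_add_cancel]
  have h : ShortComplex.homologyMap (f.shortMap A) = ShortComplex.homologyMap (g.shortMap A) :=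
    homologyMap_eq_of_τ₂_eq_add (baseChange A l) h₂ (congrArg (baseChange A) h₀)
  simp only [homologyMap, h]

lemma homologyMap_comp (g : TruncatedChainMap Y Z) (f : TruncatedChainMap X Y) :
    (g.comp f).homologyMap A = f.homologyMap A ≫ g.homologyMap A := by
  have h : ShortComplex.homologyMap ((g.comp f).shortMap A) =
      ShortComplex.homologyMap (f.shortMap A) ≫ ShortComplex.homologyMap (g.shortMap A) := by
    rw [← ShortComplex.homologyMap_comp]
    refine homologyMap_eq_of_τ₂_eq_add 0 ?_ (baseChange_comp A f.app₀ g.app₀)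
    rw [zero_comp, zero_add]
    exact baseChange_comp A f.app₁ g.app₁
  simp [homologyMap, h]

lemma homologyMap_ofHom (i : X ⟶ Y) : (ofHom i).homologyMap A = SSet.homologyMap i A 1 := by
  have h : ShortComplex.homologyMap ((ofHom i).shortMap A) = ShortComplex.homologyMap
      ((HomologicalComplex.shortComplexFunctor' C (.down ℕ) 2 1 0).map
        (SSet.chainComplexMap i A)) := by
    refine homologyMap_eq_of_τ₂_eq_add 0 ?_ (baseChange_map A i 0)
    rw [zero_comp, zero_add]
    exact baseChange_map A i 1
  rw [homologyMap, h]
  exact NatIso.naturality_2 (HomologicalComplex.homologyFunctorIso' C (.down ℕ) 2 1 0 _ _)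
    (SSet.chainComplexMap i A)

lemma homologyMap_eq_id {f : TruncatedChainMap X X} (h₀ : ∀ x, f.app₀ (.of x) = .of x)
    (h₁ : ∀ x, ChainClass.mk (f.app₁ (.of x)) = ChainClass.mk (.of x)) :
    f.homologyMap A = 𝟙 _ := by
  rw [← SSet.homologyMap_id, ← homologyMap_ofHom]
  refine homologyMap_congr ?_ fun x => ?_
  · ext x
    simp [ofHom, h₀]
  · simp [ofHom, h₁]

end TruncatedChainMap

end TruncatedChainMap

/-- The singular simplicial set of a topological space. -/
noncomputable abbrev singularSSet (X : Type u) [TopologicalSpace X] : SSet.{u} :=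
  TopCat.toSSet.obj (TopCat.of X)

namespace singularSSet

variable {X : Type u} [TopologicalSpace X]

section Simplices

/-- Singular `n`-simplices as continuous maps on the standard `n`-simplex. -/
noncomputable def simplexEquiv (n : ℕ) :
    (singularSSet X) _⦋n⦌ ≃ C(stdSimplex ℝ (Fin (n + 1)), X) :=
  TopCat.toSSetObjEquiv (TopCat.of X) (op ⦋n⦌)

lemma simplexEquiv_δ {n : ℕ} (i : Fin (n + 2)) (x : (singularSSet X) _⦋n + 1⦌)
    (s : stdSimplex ℝ (Fin (n + 1))) :
    simplexEquiv n ((singularSSet X).δ i x) s =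
      simplexEquiv (n + 1) x (stdSimplex.map i.succAbove s) :=
  rfl

/-- Singular `1`-simplices as paths, parametrised by the second barycentric coordinate. -/
noncomputable def edgeEquiv : (singularSSet X) _⦋1⦌ ≃ C(I, X) :=
  (simplexEquiv 1).trans
    (stdSimplexHomeomorphUnitInterval.continuousMapCongr (Homeomorph.refl X))

lemma edgeEquiv_apply (x : (singularSSet X) _⦋1⦌) (t : I) :
    edgeEquiv x t = simplexEquiv 1 x (stdSimplexHomeomorphUnitInterval.symm t) := rfl

lemma map_succAbove_apply_self {n : ℕ} (i : Fin (n + 2)) (s : stdSimplex ℝ (Fin (n + 1))) :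
    stdSimplex.map i.succAbove s i = 0 := by
  rw [stdSimplex.map_coe, FunOnFinite.linearMap_apply_apply]
  refine Finset.sum_eq_zero fun j hj => ?_
  exact absurd (Finset.mem_filter.1 hj).2 (Fin.succAbove_ne i j)

lemma map_succAbove_apply_succAbove {n : ℕ} (i : Fin (n + 2)) (j : Fin (n + 1))
    (s : stdSimplex ℝ (Fin (n + 1))) : stdSimplex.map i.succAbove s (i.succAbove j) = s j := by
  rw [stdSimplex.map_coe, FunOnFinite.linearMap_apply_apply]
  refine Finset.sum_eq_single_of_mem j (by simp) fun k hk hkj => ?_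
  exact absurd (Fin.succAbove_right_injective (Finset.mem_filter.1 hk).2) hkj

lemma map_succAbove_eq {n : ℕ} {i : Fin (n + 2)} {s : stdSimplex ℝ (Fin (n + 1))}
    {u : stdSimplex ℝ (Fin (n + 2))} (h₀ : u i = 0) (h₁ : ∀ j, u (i.succAbove j) = s j) :
    stdSimplex.map i.succAbove s = u := by
  refine stdSimplex.ext (funext fun k => ?_)
  induction k using i.succAboveCases with
  | x => rw [map_succAbove_apply_self, h₀]
  | p j => rw [map_succAbove_apply_succAbove, h₁]

lemma toSSetObj₀Equiv_δ_zero (x : (singularSSet X) _⦋1⦌) :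
    TopCat.toSSetObj₀Equiv ((singularSSet X).δ 0 x) = edgeEquiv x 1 :=
  (TopCat.toSSetObj₁Equiv_apply_one x).symm

lemma toSSetObj₀Equiv_δ_one (x : (singularSSet X) _⦋1⦌) :
    TopCat.toSSetObj₀Equiv ((singularSSet X).δ 1 x) = edgeEquiv x 0 :=
  (TopCat.toSSetObj₁Equiv_apply_zero x).symm

lemma edgeEquiv_δ (x : (singularSSet X) _⦋2⦌) {i : Fin 3} {u : stdSimplex ℝ (Fin 3)} {t : I}
    (h₀ : u i = 0) (h₁ : u (i.succAbove 1) = t) :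
    edgeEquiv ((singularSSet X).δ i x) t = simplexEquiv 2 x u := by
  have h : u (i.succAbove 0) = 1 - t := by
    have := stdSimplex.sum_eq_one u
    rw [Fin.sum_univ_succAbove _ i, Fin.sum_univ_two, h₀, h₁] at this
    linarith
  rw [edgeEquiv_apply, simplexEquiv_δ]
  refine congrArg (simplexEquiv 2 x) (map_succAbove_eq h₀ fun j => ?_)
  fin_cases j
  · exact h
  · exact h₁

end Simplices

/-- The class of a path, as a singular `1`-chain, modulo boundaries. -/
noncomputable def pathClass (p : C(I, X)) : ChainClass (singularSSet X) :=
  .mk (.of (edgeEquiv.symm p))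

section Affine

variable {E : Type*} [AddCommGroup E] [Module ℝ E] [TopologicalSpace E] [ContinuousAdd E]
  [ContinuousSMul ℝ E]

/-- The singular simplex obtained by composing a map `F` on a vector space with the affine simplex
with vertices `v`. -/
noncomputable def affineSimplex {n : ℕ} (F : C(E, X)) (v : Fin (n + 1) → E) :
    (singularSSet X) _⦋n⦌ :=
  (simplexEquiv n).symm ⟨fun s => F (∑ i, s i • v i), F.continuous.comp <|
    continuous_finsetSum _ fun i _ =>
      ((continuous_apply i).comp continuous_subtype_val).smul continuous_const⟩

lemma simplexEquiv_affineSimplex {n : ℕ} (F : C(E, X)) (v : Fin (n + 1) → E)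
    (s : stdSimplex ℝ (Fin (n + 1))) :
    simplexEquiv n (affineSimplex F v) s = F (∑ i, s i • v i) := by
  rw [affineSimplex, Equiv.apply_symm_apply]
  rfl

lemma δ_affineSimplex {n : ℕ} (F : C(E, X)) (v : Fin (n + 2) → E) (i : Fin (n + 2)) :
    (singularSSet X).δ i (affineSimplex F v) = affineSimplex F (v ∘ i.succAbove) := by
  refine (simplexEquiv n).injective (ContinuousMap.ext fun s => ?_)
  rw [simplexEquiv_δ, simplexEquiv_affineSimplex, simplexEquiv_affineSimplex,
    Fin.sum_univ_succAbove _ i, map_succAbove_apply_self, zero_smul, zero_add]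
  simp only [map_succAbove_apply_succAbove, Function.comp_apply]

/-- The path obtained by composing a map `F` on a vector space with the segment from `a` to `b`. -/
noncomputable def segment (F : C(E, X)) (a b : E) : C(I, X) :=
  edgeEquiv (affineSimplex F ![a, b])

@[simp]
lemma segment_apply (F : C(E, X)) (a b : E) (t : I) :
    segment F a b t = F ((1 - t : ℝ) • a + (t : ℝ) • b) := by
  rw [segment, edgeEquiv_apply, simplexEquiv_affineSimplex, Fin.sum_univ_two]
  rfl

lemma pathClass_segment_add (F : C(E, X)) (a b c : E) :
    pathClass (segment F a b) + pathClass (segment F b c) = pathClass (segment F a c) := by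
  have h := ChainClass.mk_triangle (affineSimplex F ![a, b, c])
  have h₀ : ![a, b, c] ∘ (0 : Fin 3).succAbove = ![b, c] := by ext i; fin_cases i <;> rfl
  have h₁ : ![a, b, c] ∘ (1 : Fin 3).succAbove = ![a, c] := by ext i; fin_cases i <;> rfl
  have h₂ : ![a, b, c] ∘ (2 : Fin 3).succAbove = ![a, b] := by ext i; fin_cases i <;> rfl
  simpa only [pathClass, segment, Equiv.symm_apply_apply, δ_affineSimplex, h₀, h₁, h₂] using h

lemma pathClass_segment_self (F : C(E, X)) (a : E) : pathClass (segment F a a) = 0 :=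
  add_eq_left.1 (pathClass_segment_add F a a a)

lemma sum_pathClass_segment (F : C(E, X)) (a : ℕ → E) (n : ℕ) :
    ∑ i ∈ Finset.range n, pathClass (segment F (a i) (a (i + 1))) =
      pathClass (segment F (a 0) (a n)) := by
  induction n with
  | zero => rw [Finset.sum_range_zero, pathClass_segment_self]
  | succ n ih => rw [Finset.sum_range_succ, ih, pathClass_segment_add]

end Affine

lemma pathClass_const (x : X) : pathClass (ContinuousMap.const I x) = 0 :=
  pathClass_segment_self (ContinuousMap.const ℝ x) 0

lemma pathClass_eq_of_homotopic {x y : X} {p q : Path x y} (h : p.Homotopic q) :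
    pathClass p.toContinuousMap = pathClass q.toContinuousMap := by
  obtain ⟨H⟩ := h
  let proj : C(ℝ, I) := ⟨Set.projIcc 0 1 zero_le_one, continuous_projIcc⟩
  let F : C(ℝ × ℝ, X) := (H : C(I × I, X)).comp (proj.prodMap proj)
  have bottom : segment F (0, 0) (0, 1) = p.toContinuousMap := by ext t; simp [F, proj]
  have top : segment F (1, 0) (1, 1) = q.toContinuousMap := by ext t; simp [F, proj]
  have left : segment F (0, 0) (1, 0) = ContinuousMap.const I x := by ext t; simp [F, proj]
  have right : segment F (0, 1) (1, 1) = ContinuousMap.const I y := by ext t; simp [F, proj]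
  -- The square is cut into two affine triangles along its diagonal.
  calc pathClass p.toContinuousMap
      = pathClass (segment F (0, 0) (1, 1)) := by
        rw [← pathClass_segment_add F _ (0, 1), bottom, right, pathClass_const, add_zero]
    _ = pathClass q.toContinuousMap := by
        rw [← pathClass_segment_add F _ (1, 0), left, top, pathClass_const, zero_add]

lemma pathClass_trans {x y z : X} (p : Path x y) (q : Path y z) :
    pathClass (p.trans q).toContinuousMap =
      pathClass p.toContinuousMap + pathClass q.toContinuousMap := by
  let F : C(ℝ, X) := ⟨(p.trans q).extend, (p.trans q).continuous_extend⟩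
  have whole : segment F 0 1 = (p.trans q).toContinuousMap := by ext t; simp [F]
  have first : segment F 0 2⁻¹ = p.toContinuousMap := by
    ext t
    have : (p.trans q).extend ((t : ℝ) * 2⁻¹) = p t := by
      rw [Path.extend_trans_of_le_half _ _ (by linarith [t.2.2]), mul_comm,
        inv_mul_cancel_right₀ two_ne_zero, Path.extend_apply _ t.2]
    simpa [F] using this
  have second : segment F 2⁻¹ 1 = q.toContinuousMap := by
    ext t
    have : (p.trans q).extend ((1 - t : ℝ) * 2⁻¹ + t) = q t := by
      rw [Path.extend_trans_of_half_le _ _ (by linarith [t.2.1]), ← Path.extend_apply q t.2]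
      ring_nf
    simpa [F] using this
  rw [← whole, ← first, ← second, pathClass_segment_add]

lemma pathClass_eq_of_isSimplyConnected {A : Set X} (hA : IsSimplyConnected A) {x y : X}
    {p q : Path x y} (hp : ∀ t, p t ∈ A) (hq : ∀ t, q t ∈ A) :
    pathClass p.toContinuousMap = pathClass q.toContinuousMap := by
  have := hA.simplyConnectedSpace
  have hx : x ∈ A := p.source ▸ hp 0
  have hy : y ∈ A := p.target ▸ hp 1
  let p' : Path (⟨x, hx⟩ : A) ⟨y, hy⟩ := ⟨⟨fun t => ⟨p t, hp t⟩, by fun_prop⟩, by simp, by simp⟩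
  let q' : Path (⟨x, hx⟩ : A) ⟨y, hy⟩ := ⟨⟨fun t => ⟨q t, hq t⟩, by fun_prop⟩, by simp, by simp⟩
  exact pathClass_eq_of_homotopic
    ((SimplyConnectedSpace.paths_homotopic p' q').map (⟨Subtype.val, by fun_prop⟩ : C(A, X)))

end singularSSet

section Grid

/-- The point `i / n` of the unit interval (`1` if `i > n`). -/
noncomputable def gridPoint (n i : ℕ) : I :=
  Set.projIcc 0 1 zero_le_one (i / n : ℝ)

lemma gridPoint_zero (n : ℕ) : gridPoint n 0 = 0 := by
  simp [gridPoint]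

lemma gridPoint_self {n : ℕ} (hn : 0 < n) : gridPoint n n = 1 := by
  simp [gridPoint, div_self (Nat.cast_ne_zero.2 hn.ne' : (n : ℝ) ≠ 0)]

lemma gridPoint_mul_mul {m : ℕ} (hm : 0 < m) (n i : ℕ) :
    gridPoint (n * m) (i * m) = gridPoint n i := by
  have : (m : ℝ) ≠ 0 := Nat.cast_ne_zero.2 hm.ne'
  simp only [gridPoint, Nat.cast_mul, mul_div_mul_right _ _ this]

lemma dist_gridPoint_le (n i j : ℕ) :
    dist (gridPoint n i) (gridPoint n j) ≤ |(i - j : ℝ)| / n := by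
  refine (Set.abs_projIcc_sub_projIcc zero_le_one).trans_eq ?_
  rw [← sub_div, abs_div, Nat.abs_cast]

lemma dist_gridPoint_succ_le (n i : ℕ) :
    dist (gridPoint n i) (gridPoint n (i + 1)) ≤ 1 / n := by
  simpa using dist_gridPoint_le n i (i + 1)

lemma dist_convexCombination_le (n i : ℕ) (t : I) :
    dist ((1 - t : ℝ) • (i / n : ℝ) + (t : ℝ) • ((i + 1 : ℕ) / n : ℝ)) (i / n) ≤ 1 / n := by
  have h : (1 - t : ℝ) • (i / n : ℝ) + (t : ℝ) • ((i + 1 : ℕ) / n : ℝ) = i / n + t * (1 / n) := by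
    rw [smul_eq_mul, smul_eq_mul]
    push_cast
    ring
  rw [h, dist_self_add_left, Real.norm_of_nonneg (mul_nonneg t.2.1 (by positivity))]
  exact mul_le_of_le_one_left (by positivity) t.2.2

variable {X Y Z : Type*} [PseudoMetricSpace X] [PseudoMetricSpace Y] [PseudoMetricSpace Z]

/-- The mesh `1 / n` is fine enough for `f` at scale `r`: points at distance at most `1 / n` have
images at distance less than `r`. -/
def IsFine (r : ℝ) (n : ℕ) (f : Y → X) : Prop :=
  0 < n ∧ ∀ y z, dist y z ≤ 1 / n → dist (f y) (f z) < r

namespace IsFine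

variable {r s : ℝ} {n : ℕ} {f : Y → X}

lemma pos (h : IsFine r n f) : 0 < n := h.1

lemma dist_lt (h : IsFine r n f) {y z : Y} (hyz : dist y z ≤ 1 / n) : dist (f y) (f z) < r :=
  h.2 y z hyz

lemma mono (h : IsFine r n f) (hrs : r ≤ s) : IsFine s n f :=
  ⟨h.pos, fun _ _ hyz => (h.dist_lt hyz).trans_le hrs⟩

lemma comp (h : IsFine r n f) {g : Z → Y} (hg : LipschitzWith 1 g) : IsFine r n (f ∘ g) :=
  ⟨h.pos, fun y z hyz => h.dist_lt ((hg.dist_le_mul y z).trans (by simpa using hyz))⟩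

lemma dist_gridPoint_succ_lt {p : I → X} (h : IsFine r n p) (i : ℕ) :
    dist (p (gridPoint n i)) (p (gridPoint n (i + 1))) < r :=
  h.dist_lt (dist_gridPoint_succ_le n i)

end IsFine

lemma exists_isFine [CompactSpace Y] {r : ℝ} (hr : 0 < r) {f : Y → X} (hf : Continuous f) :
    ∃ n, IsFine r n f := by
  obtain ⟨δ, hδ, h⟩ :=
    Metric.uniformContinuous_iff.1 (CompactSpace.uniformContinuous_of_continuous hf) r hr
  obtain ⟨n, hn⟩ := exists_nat_one_div_lt hδ
  exact ⟨n + 1, n.succ_pos, fun y z hyz => h (hyz.trans_lt (by exact_mod_cast hn))⟩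

end Grid

namespace Rips

variable {X : Type u} [MetricSpace X] {r s : ℝ}

section Simplices

open Classical in
lemma image_mem_faces {n : ℕ} {x : Fin (n + 1) → X} (h : ∀ i j, dist (x i) (x j) < r) :
    Finset.univ.image x ∈ (Rips X r).faces := by
  refine ⟨Finset.univ_nonempty.image _, ?_⟩
  obtain ⟨m, -, hm⟩ := Finset.exists_max_image (Finset.univ : Finset (Fin (n + 1) × Fin (n + 1)))
    (fun m => dist (x m.1) (x m.2)) Finset.univ_nonempty
  refine lt_of_le_of_lt (Metric.diam_le_of_forall_dist_le dist_nonneg ?_) (h m.1 m.2)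
  intro a ha b hb
  obtain ⟨i, -, rfl⟩ := Finset.mem_image.1 (Finset.mem_coe.1 ha)
  obtain ⟨j, -, rfl⟩ := Finset.mem_image.1 (Finset.mem_coe.1 hb)
  exact hm (i, j) (Finset.mem_univ _)

/-- The ordered simplex of the Rips complex with the given vertices. -/
def simplex {n : ℕ} (x : Fin (n + 1) → X) (h : ∀ i j, dist (x i) (x j) < r) :
    (Rips X r).orderedSSet _⦋n⦌ :=
  ⟨x, image_mem_faces h⟩

/-- The `i`-th vertex of an ordered simplex of the Rips complex. -/
def vertex {n : ℕ} (τ : (Rips X r).orderedSSet _⦋n⦌) (i : Fin (n + 1)) : X := τ.1 i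

lemma simplex_ext {n : ℕ} {τ τ' : (Rips X r).orderedSSet _⦋n⦌}
    (h : ∀ i, vertex τ i = vertex τ' i) : τ = τ' :=
  Subtype.ext (funext h)

lemma dist_vertex_lt {n : ℕ} (τ : (Rips X r).orderedSSet _⦋n⦌) (i j : Fin (n + 1)) :
    dist (vertex τ i) (vertex τ j) < r := by
  classical
  refine lt_of_le_of_lt (Metric.dist_le_diam_of_mem (Finset.finite_toSet _).isBounded ?_ ?_) τ.2.2
  · exact Finset.mem_coe.2 (Finset.mem_image_of_mem τ.1 (Finset.mem_univ i))
  · exact Finset.mem_coe.2 (Finset.mem_image_of_mem τ.1 (Finset.mem_univ j))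

/-- The `0`-simplex given by a point. -/
def pointSimplex (hr : 0 < r) (x : X) : (Rips X r).orderedSSet _⦋0⦌ :=
  simplex (fun _ => x) (by simpa)

lemma pointSimplex_vertex (hr : 0 < r) (τ : (Rips X r).orderedSSet _⦋0⦌) :
    pointSimplex hr (vertex τ 0) = τ :=
  simplex_ext fun i => by fin_cases i; rfl

/-- The `1`-simplex given by an ordered pair of points at distance less than `r`. -/
def edge {x y : X} (h : dist x y < r) : (Rips X r).orderedSSet _⦋1⦌ :=
  simplex ![x, y] fun i j => by
    have hr := dist_nonneg.trans_lt h
    fin_cases i <;> fin_cases j <;> simp [hr, h, dist_comm y x]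

lemma edge_vertex (τ : (Rips X r).orderedSSet _⦋1⦌) : edge (dist_vertex_lt τ 0 1) = τ :=
  simplex_ext fun i => by fin_cases i <;> rfl

lemma δ_zero_edge (hr : 0 < r) {x y : X} (h : dist x y < r) :
    (Rips X r).orderedSSet.δ 0 (edge h) = pointSimplex hr y :=
  simplex_ext fun i => by fin_cases i; rfl

lemma δ_one_edge (hr : 0 < r) {x y : X} (h : dist x y < r) :
    (Rips X r).orderedSSet.δ 1 (edge h) = pointSimplex hr x :=
  simplex_ext fun i => by fin_cases i; rfl

end Simplices

section Edges

variable (r) in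
open Classical in
/-- The edge from `x` to `y` as an integral chain of the Rips complex; it is `0` if `x` and `y` do
not span an edge. -/
noncomputable def edgeChain (x y : X) : IntegralChain (Rips X r).orderedSSet 1 :=
  if h : dist x y < r then .of (edge h) else 0

lemma edgeChain_of_lt {x y : X} (h : dist x y < r) : edgeChain r x y = .of (edge h) :=
  dif_pos h

lemma boundary_edgeChain (hr : 0 < r) {x y : X} (h : dist x y < r) :
    IntegralChain.boundary (Rips X r).orderedSSet 0 (edgeChain r x y) =
      .of (pointSimplex hr y) - .of (pointSimplex hr x) := by
  rw [edgeChain_of_lt h, IntegralChain.boundary_zero_of, δ_zero_edge hr, δ_one_edge hr]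

lemma map_orderedSSetIncl_edgeChain (hrs : r ≤ s) {x y : X} (h : dist x y < r) :
    FreeAbelianGroup.map ((PreAbstractSimplicialComplex.orderedSSetIncl (Rips_mono X hrs)).app
      (op ⦋1⦌)) (edgeChain r x y) = edgeChain s x y := by
  rw [edgeChain_of_lt h, edgeChain_of_lt (h.trans_le hrs), FreeAbelianGroup.map_of_apply]
  rfl

variable (r) in
/-- The class of the edge from `x` to `y` modulo boundaries. -/
noncomputable def edgeClass (x y : X) : ChainClass (Rips X r).orderedSSet :=
  .mk (edgeChain r x y)

lemma mk_of (τ : (Rips X r).orderedSSet _⦋1⦌) :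
    ChainClass.mk (.of τ) = edgeClass r (vertex τ 0) (vertex τ 1) := by
  rw [edgeClass, edgeChain_of_lt (dist_vertex_lt τ 0 1), edge_vertex]

lemma edgeClass_add {x y z : X} (hxy : dist x y < r) (hyz : dist y z < r) (hxz : dist x z < r) :
    edgeClass r x y + edgeClass r y z = edgeClass r x z := by
  have hr := dist_nonneg.trans_lt hxy
  have h : ∀ i j, dist (![x, y, z] i) (![x, y, z] j) < r := by
    intro i j
    fin_cases i <;> fin_cases j <;>
      simp [hr, hxy, hyz, hxz, dist_comm y x, dist_comm z x, dist_comm z y]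
  have key := ChainClass.mk_triangle (simplex ![x, y, z] h)
  rwa [mk_of, mk_of, mk_of] at key

lemma edgeClass_self (x : X) : edgeClass r x x = 0 := by
  by_cases hr : dist x x < r
  · exact add_eq_left.1 (edgeClass_add hr hr hr)
  · rw [edgeClass, edgeChain, dif_neg hr, map_zero]

lemma sum_edgeClass {q : ℕ → X} {n : ℕ} (h₀ : ∀ i ≤ n, dist (q 0) (q i) < r)
    (h₁ : ∀ i < n, dist (q i) (q (i + 1)) < r) :
    ∑ i ∈ Finset.range n, edgeClass r (q i) (q (i + 1)) = edgeClass r (q 0) (q n) := by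
  induction n with
  | zero => simp [edgeClass_self]
  | succ n ih =>
    rw [Finset.sum_range_succ, ih (fun i hi => h₀ i (by lia)) (fun i hi => h₁ i (by lia)),
      edgeClass_add (h₀ n (by lia)) (h₁ n (by lia)) (h₀ (n + 1) le_rfl)]

lemma sum_edgeClass_mul {q : ℕ → X} {m : ℕ} (n : ℕ)
    (h : ∀ i j k, j ≤ m → k ≤ m → dist (q (i * m + j)) (q (i * m + k)) < r) :
    ∑ i ∈ Finset.range (n * m), edgeClass r (q i) (q (i + 1)) =
      ∑ i ∈ Finset.range n, edgeClass r (q (i * m)) (q ((i + 1) * m)) := by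
  induction n with
  | zero => simp
  | succ n ih =>
    have block : ∑ j ∈ Finset.range m, edgeClass r (q (n * m + j)) (q (n * m + j + 1)) =
        edgeClass r (q (n * m)) (q (n * m + m)) :=
      sum_edgeClass (q := fun j => q (n * m + j)) (fun j hj => h n 0 j m.zero_le hj)
        fun j hj => h n j (j + 1) hj.le hj
    rw [Nat.succ_mul, Finset.sum_range_add, ih, Finset.sum_range_succ, block, Nat.succ_mul]

lemma sum_edgeClass_strip {p q : ℕ → X} (n : ℕ) (hp : ∀ i, dist (p i) (p (i + 1)) < r)
    (hq : ∀ i, dist (q i) (q (i + 1)) < r) (hpq : ∀ i, dist (p i) (q i) < r)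
    (hpq' : ∀ i, dist (p i) (q (i + 1)) < r) :
    ∑ i ∈ Finset.range n, edgeClass r (p i) (p (i + 1)) + edgeClass r (p n) (q n) =
      edgeClass r (p 0) (q 0) + ∑ i ∈ Finset.range n, edgeClass r (q i) (q (i + 1)) := by
  -- Each cell is cut into two triangles by the edge from `p i` to `q (i + 1)`.
  induction n with
  | zero => simp
  | succ n ih =>
    rw [Finset.sum_range_succ, Finset.sum_range_succ, ← add_assoc (edgeClass r (p 0) (q 0)), ← ih,
      add_assoc, add_assoc, edgeClass_add (hp n) (hpq (n + 1)) (hpq' n),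
      edgeClass_add (hpq n) (hq n) (hpq' n)]

end Edges

section Sampling

variable (r) in
/-- The chain of edges through the values of `p` at `0, 1 / n, 2 / n, …, 1`. -/
noncomputable def sampleChain (p : I → X) (n : ℕ) : IntegralChain (Rips X r).orderedSSet 1 :=
  ∑ i ∈ Finset.range n, edgeChain r (p (gridPoint n i)) (p (gridPoint n (i + 1)))

variable {n m : ℕ} {p : I → X}

lemma boundary_sampleChain (hr : 0 < r) (h : IsFine r n p) :
    IntegralChain.boundary (Rips X r).orderedSSet 0 (sampleChain r p n) =
      .of (pointSimplex hr (p 1)) - .of (pointSimplex hr (p 0)) := by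
  simp only [sampleChain, map_sum, boundary_edgeChain hr (h.dist_gridPoint_succ_lt _)]
  rw [Finset.sum_range_sub fun i => FreeAbelianGroup.of (pointSimplex hr (p (gridPoint n i))),
    gridPoint_self h.pos, gridPoint_zero]

lemma map_orderedSSetIncl_sampleChain (hrs : r ≤ s) (h : IsFine r n p) :
    FreeAbelianGroup.map ((PreAbstractSimplicialComplex.orderedSSetIncl (Rips_mono X hrs)).app
      (op ⦋1⦌)) (sampleChain r p n) = sampleChain s p n := by
  simp only [sampleChain, map_sum,
    map_orderedSSetIncl_edgeChain hrs (h.dist_gridPoint_succ_lt _)]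

variable (r) in
/-- The class modulo boundaries of the chain of edges through the values of `p` at
`0, 1 / n, 2 / n, …, 1`. -/
noncomputable def sampleClass (p : I → X) (n : ℕ) : ChainClass (Rips X r).orderedSSet :=
  .mk (sampleChain r p n)

lemma sampleClass_eq_sum (p : I → X) (n : ℕ) : sampleClass r p n =
    ∑ i ∈ Finset.range n, edgeClass r (p (gridPoint n i)) (p (gridPoint n (i + 1))) :=
  map_sum _ _ _

lemma sampleClass_const (x : X) (n : ℕ) : sampleClass r (fun _ => x) n = 0 := by
  simp [sampleClass_eq_sum, edgeClass_self]

lemma sampleClass_eq_edgeClass (h : IsFine r n p) (h₀ : ∀ t, dist (p 0) (p t) < r) :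
    sampleClass r p n = edgeClass r (p 0) (p 1) := by
  rw [← gridPoint_zero n] at h₀ ⊢
  rw [sampleClass_eq_sum, ← gridPoint_self h.pos]
  exact sum_edgeClass (q := fun i => p (gridPoint n i)) (fun i _ => h₀ _)
    fun i _ => h.dist_gridPoint_succ_lt i

lemma sampleClass_mul (h : IsFine r n p) (hm : 0 < m) :
    sampleClass r p (n * m) = sampleClass r p n := by
  simp only [sampleClass_eq_sum, ← gridPoint_mul_mul hm n]
  refine sum_edgeClass_mul (q := fun i => p (gridPoint (n * m) i)) n fun i j k hj hk => ?_
  refine h.dist_lt ((dist_gridPoint_le _ _ _).trans ?_)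
  have hjk : |(j - k : ℝ)| ≤ m := by
    rw [abs_sub_le_iff]
    exact ⟨by linarith [(Nat.cast_le (α := ℝ)).2 hj, k.cast_nonneg (α := ℝ)],
      by linarith [(Nat.cast_le (α := ℝ)).2 hk, j.cast_nonneg (α := ℝ)]⟩
  calc |((i * m + j : ℕ) - (i * m + k : ℕ) : ℝ)| / (n * m : ℕ)
      = |(j - k : ℝ)| / m / n := by
        rw [Nat.cast_add, Nat.cast_add, add_sub_add_left_eq_sub, Nat.cast_mul, div_div, mul_comm]
    _ ≤ 1 / n := by gcongr; exact div_le_one_of_le₀ hjk m.cast_nonneg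

lemma sampleClass_eq_sampleClass (hn : IsFine r n p) (hm : IsFine r m p) :
    sampleClass r p n = sampleClass r p m := by
  rw [← sampleClass_mul hn hm.pos, mul_comm, sampleClass_mul hm hn.pos]

lemma sampleClass_square {F : I × I → X} (h : IsFine r n F) :
    sampleClass r (fun t => F (0, t)) n + sampleClass r (fun t => F (t, 1)) n =
      sampleClass r (fun t => F (t, 0)) n + sampleClass r (fun t => F (1, t)) n := by
  let row (i : ℕ) : ChainClass (Rips X r).orderedSSet :=
    sampleClass r (fun t => F (gridPoint n i, t)) n
  have strip (i : ℕ) :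
      edgeClass r (F (gridPoint n i, 1)) (F (gridPoint n (i + 1), 1)) -
        edgeClass r (F (gridPoint n i, 0)) (F (gridPoint n (i + 1), 0)) = row (i + 1) - row i := by
    have hd (i j : ℕ) {k l : I} (hk : dist (gridPoint n i) k ≤ 1 / n)
        (hl : dist (gridPoint n j) l ≤ 1 / n) :
        dist (F (gridPoint n i, gridPoint n j)) (F (k, l)) < r := h.dist_lt (max_le hk hl)
    have h₁ (i : ℕ) := dist_gridPoint_succ_le n i
    have h₀ (i : ℕ) : dist (gridPoint n i) (gridPoint n i) ≤ 1 / n := by simp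
    rw [sub_eq_sub_iff_add_eq_add, add_comm, add_comm (row (i + 1))]
    simp only [row, sampleClass_eq_sum, ← gridPoint_zero n, ← gridPoint_self h.pos]
    exact sum_edgeClass_strip (p := fun j => F (gridPoint n i, gridPoint n j))
      (q := fun j => F (gridPoint n (i + 1), gridPoint n j)) n (fun j => hd _ j (h₀ _) (h₁ j))
      (fun j => hd _ j (h₀ _) (h₁ j)) (fun j => hd i _ (h₁ i) (h₀ _)) fun j => hd i j (h₁ i) (h₁ j)
  have total : sampleClass r (fun t => F (t, 1)) n - sampleClass r (fun t => F (t, 0)) n =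
      row n - row 0 := by
    simp only [sampleClass_eq_sum (fun t => F (t, _)), ← Finset.sum_sub_distrib, strip,
      Finset.sum_range_sub]
  simp only [row, gridPoint_self h.pos, gridPoint_zero] at total
  rw [add_comm, sub_eq_sub_iff_add_eq_add.1 total, add_comm]

end Sampling

open singularSSet

section PathSampling

variable (hr : 0 < r)

/-- The chain of edges through the values of a path at the points of a fine enough grid. -/
noncomputable def pathSample (p : C(I, X)) : IntegralChain (Rips X r).orderedSSet 1 :=
  sampleChain r p (exists_isFine hr p.continuous).choose

lemma exists_pathSample_eq (p : C(I, X)) :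
    ∃ n, IsFine r n p ∧ pathSample hr p = sampleChain r p n :=
  ⟨_, (exists_isFine hr p.continuous).choose_spec, rfl⟩

lemma mk_pathSample {p : C(I, X)} {n : ℕ} (h : IsFine r n p) :
    ChainClass.mk (pathSample hr p) = sampleClass r p n := by
  obtain ⟨m, hm, hp⟩ := exists_pathSample_eq hr p
  rw [hp]
  exact sampleClass_eq_sampleClass hm h

lemma boundary_pathSample (p : C(I, X)) :
    IntegralChain.boundary (Rips X r).orderedSSet 0 (pathSample hr p) =
      .of (pointSimplex hr (p 1)) - .of (pointSimplex hr (p 0)) := by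
  obtain ⟨n, hn, hp⟩ := exists_pathSample_eq hr p
  rw [hp, boundary_sampleChain hr hn]

lemma mk_map_pathSample (hs : 0 < s) (hrs : r ≤ s) (p : C(I, X)) :
    ChainClass.mk (FreeAbelianGroup.map
      ((PreAbstractSimplicialComplex.orderedSSetIncl (Rips_mono X hrs)).app (op ⦋1⦌))
        (pathSample hr p)) = ChainClass.mk (pathSample hs p) := by
  obtain ⟨n, hn, hp⟩ := exists_pathSample_eq hr p
  rw [hp, map_orderedSSetIncl_sampleChain hrs hn, mk_pathSample hs (hn.mono hrs), sampleClass]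

/-- The map from the square to the standard triangle that contracts one side of the square to the
vertex `0` and maps the three other sides onto the sides of the triangle. -/
noncomputable def squareToTriangle : C(I × I, stdSimplex ℝ (Fin 3)) where
  toFun z := ⟨![1 - z.2, z.2 * (1 - z.1), z.2 * z.1], by
    obtain ⟨⟨s, hs₀, hs₁⟩, ⟨t, ht₀, ht₁⟩⟩ := z
    refine ⟨fun i => ?_, by rw [Fin.sum_univ_three]; simp; ring⟩
    fin_cases i
    · exact sub_nonneg.2 ht₁
    · exact mul_nonneg ht₀ (sub_nonneg.2 hs₁)
    · exact mul_nonneg ht₀ hs₀⟩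
  continuous_toFun := by
    refine Continuous.subtype_mk (continuous_pi fun i => ?_) _
    fin_cases i
    · exact continuous_const.sub (by fun_prop)
    · exact Continuous.mul (by fun_prop) (continuous_const.sub (by fun_prop))
    · exact Continuous.mul (by fun_prop) (by fun_prop)

lemma squareToTriangle_apply (z : I × I) (i : Fin 3) :
    squareToTriangle z i = (![1 - z.2, z.2 * (1 - z.1), z.2 * z.1] : Fin 3 → ℝ) i :=
  rfl

lemma mk_pathSample_triangle (x : (singularSSet X) _⦋2⦌) :
    ChainClass.mk (pathSample hr (edgeEquiv ((singularSSet X).δ 2 x))) +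
        ChainClass.mk (pathSample hr (edgeEquiv ((singularSSet X).δ 0 x))) =
      ChainClass.mk (pathSample hr (edgeEquiv ((singularSSet X).δ 1 x))) := by
  let F : C(I × I, X) := (simplexEquiv 2 x).comp squareToTriangle
  obtain ⟨n, hF⟩ := exists_isFine hr F.continuous
  have bottom : ⇑(edgeEquiv ((singularSSet X).δ 2 x)) = fun t => F (0, t) :=
    funext fun t => edgeEquiv_δ x (by simp [squareToTriangle_apply])
      (by simp [squareToTriangle_apply, Fin.succAbove])
  have right : ⇑(edgeEquiv ((singularSSet X).δ 0 x)) = fun t => F (t, 1) :=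
    funext fun t => edgeEquiv_δ x (by simp [squareToTriangle_apply])
      (by simp [squareToTriangle_apply, Fin.succAbove])
  have top : ⇑(edgeEquiv ((singularSSet X).δ 1 x)) = fun t => F (1, t) :=
    funext fun t => edgeEquiv_δ x (by simp [squareToTriangle_apply])
      (by simp [squareToTriangle_apply, Fin.succAbove])
  have left : (fun t => F (t, 0)) = fun _ => F (0, 0) :=
    funext fun t => congrArg (simplexEquiv 2 x) (Subtype.ext (by simp [squareToTriangle]))
  have fine_vertical (a : I) : IsFine r n fun t => F (a, t) := hF.comp (.prodMk_left a)
  have fine_horizontal (b : I) : IsFine r n fun t => F (t, b) := hF.comp (.prodMk_right b)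
  rw [mk_pathSample hr (bottom ▸ fine_vertical 0), mk_pathSample hr (right ▸ fine_horizontal 1),
    mk_pathSample hr (top ▸ fine_vertical 1), bottom, right, top, sampleClass_square hF, left,
    sampleClass_const, zero_add]

/-- The chain map in low degrees that replaces a singular edge by a fine chain of Rips edges. -/
noncomputable def sampling : TruncatedChainMap (singularSSet X) (Rips X r).orderedSSet where
  app₀ := FreeAbelianGroup.map fun x => pointSimplex hr (TopCat.toSSetObj₀Equiv x)
  app₁ := FreeAbelianGroup.lift fun x => pathSample hr (edgeEquiv x)
  boundary_app₁ x := by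
    rw [FreeAbelianGroup.lift_apply_of, boundary_pathSample, IntegralChain.boundary_zero_of,
      map_sub, FreeAbelianGroup.map_of_apply, FreeAbelianGroup.map_of_apply,
      toSSetObj₀Equiv_δ_zero, toSSetObj₀Equiv_δ_one]
  app₁_boundary x := by
    rw [ChainClass.map_boundary_mem_range_iff]
    simp only [FreeAbelianGroup.lift_apply_of]
    exact mk_pathSample_triangle hr x

end PathSampling

section Filling

/-- A path between two points at distance less than `r`, in the ball of radius `r` around the first
one. -/
noncomputable def shortPath (hconn : ∀ x : X, IsPathConnected (Metric.ball x r)) {x y : X}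
    (h : dist x y < r) : Path x y :=
  ((hconn x).joinedIn x (Metric.mem_ball_self (dist_nonneg.trans_lt h)) y
    (Metric.mem_ball'.2 h)).somePath

lemma shortPath_mem (hconn : ∀ x : X, IsPathConnected (Metric.ball x r)) {x y : X}
    (h : dist x y < r) (t : I) : shortPath hconn h t ∈ Metric.ball x r :=
  JoinedIn.somePath_mem _ t

variable (hconn : ∀ x : X, IsPathConnected (Metric.ball x r))
  (hsc : ∀ x : X, IsSimplyConnected (Metric.ball x (2 * r)))

include hsc in
lemma pathClass_eq_shortPath {x y : X} (h : dist x y < r) {p : Path x y}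
    (hp : ∀ t, p t ∈ Metric.ball x (2 * r)) :
    pathClass p.toContinuousMap = pathClass (shortPath hconn h).toContinuousMap := by
  have hr := dist_nonneg.trans_lt h
  exact pathClass_eq_of_isSimplyConnected (hsc x) hp fun t =>
    Metric.ball_subset_ball (by linarith) (shortPath_mem hconn h t)

include hsc in
lemma pathClass_shortPath_add {x y z : X} (hxy : dist x y < r) (hyz : dist y z < r)
    (hxz : dist x z < r) :
    pathClass (shortPath hconn hxy).toContinuousMap +
        pathClass (shortPath hconn hyz).toContinuousMap =
      pathClass (shortPath hconn hxz).toContinuousMap := by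
  have hr := dist_nonneg.trans_lt hxy
  rw [← pathClass_trans]
  refine pathClass_eq_shortPath hconn hsc hxz fun t => ?_
  have ht := Set.mem_range_self (f := (shortPath hconn hxy).trans (shortPath hconn hyz)) t
  rw [Path.trans_range] at ht
  rcases ht with ⟨a, ha⟩ | ⟨a, ha⟩
  · exact ha ▸ Metric.ball_subset_ball (by linarith) (shortPath_mem hconn hxy a)
  · refine ha ▸ Metric.ball_subset_ball' ?_ (shortPath_mem hconn hyz a)
    linarith [dist_comm x y]

/-- The chain map in low degrees that replaces a Rips edge by a short path. -/
noncomputable def filling : TruncatedChainMap (Rips X r).orderedSSet (singularSSet X) where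
  app₀ := FreeAbelianGroup.map fun τ => TopCat.toSSetObj₀Equiv.symm (vertex τ 0)
  app₁ := FreeAbelianGroup.map fun τ =>
    edgeEquiv.symm (shortPath hconn (dist_vertex_lt τ 0 1)).toContinuousMap
  boundary_app₁ τ := by
    simp only [FreeAbelianGroup.map_of_apply, IntegralChain.boundary_zero_of, map_sub]
    congr 2
    · rw [Equiv.eq_symm_apply, toSSetObj₀Equiv_δ_zero, Equiv.apply_symm_apply]
      exact Path.target _
    · rw [Equiv.eq_symm_apply, toSSetObj₀Equiv_δ_one, Equiv.apply_symm_apply]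
      exact Path.source _
  app₁_boundary τ := by
    rw [ChainClass.map_boundary_mem_range_iff]
    simp only [FreeAbelianGroup.map_of_apply]
    exact pathClass_shortPath_add hconn hsc (dist_vertex_lt τ 0 1) (dist_vertex_lt τ 1 2)
      (dist_vertex_lt τ 0 2)

variable (hr : 0 < r)

lemma mk_pathSample_shortPath {x y : X} (h : dist x y < r) :
    ChainClass.mk (pathSample hr (shortPath hconn h).toContinuousMap) = edgeClass r x y := by
  obtain ⟨n, hn⟩ := exists_isFine hr (shortPath hconn h).continuous
  have h₀ (t : I) : dist (shortPath hconn h 0) (shortPath hconn h t) < r := by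
    rw [Path.source]
    exact Metric.mem_ball'.1 (shortPath_mem hconn h t)
  rw [mk_pathSample hr (p := (shortPath hconn h).toContinuousMap) hn]
  refine (sampleClass_eq_edgeClass hn h₀).trans ?_
  rw [Path.source, Path.target]

lemma mk_filling_edgeChain {x y : X} (h : dist x y < r) :
    ChainClass.mk ((filling hconn hsc).app₁ (edgeChain r x y)) =
      pathClass (shortPath hconn h).toContinuousMap := by
  rw [edgeChain_of_lt h]
  exact congrArg ChainClass.mk (FreeAbelianGroup.map_of_apply _)

lemma mk_filling_pathSample (p : C(I, X)) :
    ChainClass.mk ((filling hconn hsc).app₁ (pathSample hr p)) = pathClass p := by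
  obtain ⟨n, hn, hpn⟩ := exists_pathSample_eq hr p
  let proj : C(ℝ, I) := ⟨Set.projIcc 0 1 zero_le_one, continuous_projIcc⟩
  let F : C(ℝ, X) := p.comp proj
  have hF : IsFine r n F := hn.comp (LipschitzWith.projIcc zero_le_one)
  have whole : segment F (0 / n) (n / n) = p := by
    ext t
    simp [F, proj, div_self (Nat.cast_ne_zero.2 hn.pos.ne' : (n : ℝ) ≠ 0)]
  have sum := sum_pathClass_segment F (fun i => (i / n : ℝ)) n
  rw [Nat.cast_zero, whole] at sum
  rw [hpn, sampleChain, map_sum, map_sum, ← sum]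
  refine Finset.sum_congr rfl fun i _ => ?_
  have hi := hn.dist_gridPoint_succ_lt i
  let q : Path (p (gridPoint n i)) (p (gridPoint n (i + 1))) :=
    ⟨segment F (i / n) ((i + 1 : ℕ) / n), by simp [F, proj, gridPoint],
      by simp [F, proj, gridPoint]⟩
  rw [mk_filling_edgeChain hconn hsc hi]
  refine (pathClass_eq_shortPath hconn hsc hi (p := q) fun t => ?_).symm
  refine Metric.ball_subset_ball (by linarith : r ≤ 2 * r) ?_
  rw [Metric.mem_ball]
  have := hF.dist_lt (dist_convexCombination_le n i t)
  rwa [← segment_apply] at this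

variable {C : Type*} [Category* C] [Preadditive C] [HasCoproducts.{u} C] [CategoryWithHomology C]
  (A : C)

include hconn hsc in
theorem isIso_homologyMap_sampling : IsIso ((sampling (X := X) hr).homologyMap A) := by
  refine ⟨(filling hconn hsc).homologyMap A, ?_, ?_⟩
  · rw [← TruncatedChainMap.homologyMap_comp]
    refine TruncatedChainMap.homologyMap_eq_id (fun x => ?_) fun x => ?_
    · simp only [TruncatedChainMap.comp, sampling, filling, AddMonoidHom.comp_apply,
        FreeAbelianGroup.map_of_apply]
      exact congrArg FreeAbelianGroup.of (Equiv.symm_apply_apply TopCat.toSSetObj₀Equiv x)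
    · simp only [TruncatedChainMap.comp, sampling, AddMonoidHom.comp_apply,
        FreeAbelianGroup.lift_apply_of]
      rw [mk_filling_pathSample, pathClass, Equiv.symm_apply_apply]
  · rw [← TruncatedChainMap.homologyMap_comp]
    refine TruncatedChainMap.homologyMap_eq_id (fun τ => ?_) fun τ => ?_
    · simp only [TruncatedChainMap.comp, sampling, filling, AddMonoidHom.comp_apply,
        FreeAbelianGroup.map_of_apply, Equiv.apply_symm_apply, pointSimplex_vertex]
    · simp only [TruncatedChainMap.comp, sampling, filling, AddMonoidHom.comp_apply,
        FreeAbelianGroup.map_of_apply, FreeAbelianGroup.lift_apply_of, Equiv.apply_symm_apply]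
      rw [mk_pathSample_shortPath, mk_of]

lemma homologyMap_sampling_comp_incl (hs : 0 < s) (hrs : r ≤ s) :
    (sampling (X := X) hr).homologyMap A ≫
        SSet.homologyMap (PreAbstractSimplicialComplex.orderedSSetIncl (Rips_mono X hrs)) A 1 =
      (sampling hs).homologyMap A := by
  rw [← TruncatedChainMap.homologyMap_ofHom, ← TruncatedChainMap.homologyMap_comp]
  refine TruncatedChainMap.homologyMap_congr ?_ fun x => ?_
  · ext x
    simp only [TruncatedChainMap.comp, TruncatedChainMap.ofHom, sampling, AddMonoidHom.comp_apply,
      FreeAbelianGroup.map_of_apply]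
    rfl
  · simp only [TruncatedChainMap.comp, TruncatedChainMap.ofHom, sampling, AddMonoidHom.comp_apply,
      FreeAbelianGroup.lift_apply_of]
    exact mk_map_pathSample hr hs hrs _

end Filling

end Rips

theorem theorem4p10_general {C : Type*} [Category* C] [Preadditive C] [HasCoproducts.{u} C]
    [CategoryWithHomology C] (X : Type u) [MetricSpace X] (A : C) {R : ℝ}
    (hX : SimplyConnectedUpToScale X R) {r : ℝ} (hr : 0 < r) (hrR : r < R / 2) :
    Nonempty ((Rips X r).orderedSSet.homology A 1 ≅
      ((AlgebraicTopology.singularHomologyFunctor C 1).obj A).obj (TopCat.of X)) ∧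
    ∀ (r' : ℝ) (hrr' : r < r'), r' < R / 2 →
      IsIso (SSet.homologyMap
        (PreAbstractSimplicialComplex.orderedSSetIncl (Rips_mono X hrr'.le)) A 1) := by
  have isIso_sampling {s : ℝ} (hs : 0 < s) (hsR : s < R / 2) :
      IsIso ((Rips.sampling (X := X) hs).homologyMap A) :=
    Rips.isIso_homologyMap_sampling (fun x => (hX x s hs (by linarith)).isPathConnected)
      (fun x => hX x (2 * s) (by linarith) (by linarith)) hs A
  have := isIso_sampling hr hrR
  refine ⟨⟨(asIso ((Rips.sampling (X := X) hr).homologyMap A)).symm⟩, fun r' hrr' hr'R => ?_⟩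
  have hr' := hr.trans hrr'
  have := isIso_sampling hr' hr'R
  rw [← Rips.homologyMap_sampling_comp_incl hr A hr' hrr'.le] at this
  exact IsIso.of_isIso_comp_left ((Rips.sampling (X := X) hr).homologyMap A) _

theorem theorem4p10 (X : Type u) [MetricSpace X] [CompactSpace X]
    (G : Type (max u v)) [AddCommGroup G] (R : ℝ) (hR : 0 < R)
    (hX : SimplyConnectedUpToScale X R) (r : ℝ) (hr : 0 < r) (hrR : r < R / 3) :
    Nonempty ((Rips X r).simplicialHomology (AddCommGrpCat.of G) 1 ≅
      singularHomologyGroup X (AddCommGrpCat.of G) 1) ∧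
    ∀ (r' : ℝ) (hrr' : r < r'), r' < R / 3 →
      IsIso (PreAbstractSimplicialComplex.simplicialHomologyIncl (Rips_mono X hrr'.le)
        (AddCommGrpCat.of G) 1) := by
  obtain ⟨iso, isIso⟩ := theorem4p10_general X (AddCommGrpCat.of G) hX hr (by linarith)
  exact ⟨iso, fun r' hrr' hr'R => isIso r' hrr' (by linarith)⟩
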